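/- Let $n\ge 2t+1$ and let $s$ be one of $n$ processes (the *sender*). Then sequenced reliable broadcast with sender $s$ can be solved from unidirectional communication and unforgeable transferable signatures, tolerating up to $t$ Byzantine processes. That is, there is a deterministic protocol all of whose executions in the following model, for every set of at most $t$ Byzantine processes, have properties (1)–(5). **Model.** The system is asynchronous. Processes that are not Byzantine are *correct* and follow the protocol. A correct process performs rounds $1,2,3,\dots$ in order; it begins a round, when it chooses to and only once the communication layer has reported that its previous round is finished, by sending a message to all processes. Every round of a correct process eventually finishes, and until the process begins the next round it is offered the opportunity to do so again and again. A message received from a correct process was sent earlier by that process in the indicated round, and every message sent by a correct process is eventually received by every correct process. *Unidirectionality*: if two distinct correct processes $p$ and $q$ both send in round $r$, then $p$ receives $q$'s round-$r$ message before the beginning of $p$'s next round, or $q$ receives $p$'s round-$r$ message before the beginning of $q$'s next round. *Signatures*: the protocol lets a process send a signature of another process only if it received that signature earlier; Byzantine processes may collude and send arbitrary messages, different ones to different processes, except that a signature of a correct process that occurs in them must have been contained in a message sent earlier by that correct process. If $s$ is correct, it may be asked at any times to broadcast any number of values; its $k$-th broadcast has sequence number $k$ ($k=1,2,\dots$). **Sequenced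 reliable broadcast.** 1. (Validity) If $s$ is correct and broadcasts $m$ with sequence number $k$, then every correct process eventually delivers $m$ with sequence number $k$. 2. (Agreement) If some correct process delivers $m$ with sequence number $k$, then eventually every correct process delivers $m$ with sequence number $k$. 3. (Sequencing) If a correct process delivers a message with sequence number $k$ at some time, then $k\ge1$ and it delivered messages with all sequence numbers $1\le k'<k$ before that time. 4. (Integrity) If $s$ is correct and some correct process delivers $m$ with sequence number $k$, then $s$ broadcast $m$ with sequence number $k$ at some earlier time. 5. (Uniqueness) A correct process delivers at most once with each sequence number. -/

import Mathlib

universe u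

namespace SRB

/-! ## Messages with unforgeable transferable signatures (symbolic model) -/

/-- Messages exchanged by `n` processes, over a type `V` of application values.
`signed p m` is the message `m` together with a signature of `p` on it. -/
inductive Msg (n : ℕ) (V : Type u) : Type u
  | empty : Msg n V
  | num (k : ℕ) : Msg n V
  | val (v : V) : Msg n V
  | pair (a b : Msg n V) : Msg n V
  | signed (p : Fin n) (m : Msg n V) : Msg n V

/-- `m.HasSig p x`: a signature of `p` on `x` occurs somewhere inside `m`. -/
def Msg.HasSig {n : ℕ} {V : Type u} : Msg n V → Fin n → Msg n V → Prop
  | .empty, _, _ => False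
  | .num _, _, _ => False
  | .val _, _, _ => False
  | .pair a b, p, x => a.HasSig p x ∨ b.HasSig p x
  | .signed q m, p, x => (q = p ∧ m = x) ∨ m.HasSig p x

/-! ## Protocols -/

/-- What can happen at one process. -/
inductive LocalEvent (n : ℕ) (V : Type u) : Type u
  /-- The application invokes `broadcast v`. -/
  | broadcast (v : V) : LocalEvent n V
  /-- A message arrives that process `q` sent in round `r` of `q`. -/
  | receive (q : Fin n) (r : ℕ) (m : Msg n V) : LocalEvent n V
  /-- The current round is finished, and the process is given the opportunity to begin its
  next round. -/
  | poll : LocalEvent n V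

/-- A deterministic protocol: one state machine for each process. -/
structure Protocol (n : ℕ) (V : Type u) where
  State : Type u
  init : Fin n → State
  /-- The new state after a local event. -/
  step : Fin n → State → LocalEvent n V → State
  /-- When `p` is polled in a state where this is `some m`, it begins its next round by sending
  `m` to all processes; where it is `none`, `p` declines and keeps waiting for messages. -/
  send : Fin n → State → Option (Msg n V)
  /-- The pair of a sequence number and a value that `p` delivers (if any) when the local event
  occurs in the given state. -/
  deliver : Fin n → State → LocalEvent n V → Option (ℕ × V)

/-- A schedule: the event that happens at time `i` and the process at which it happens.
Events at Byzantine processes have no meaning; what these processes do is visible only in the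
messages that correct processes receive from them. -/
abbrev Schedule (n : ℕ) (V : Type u) : Type u := ℕ → Fin n × LocalEvent n V

variable {n : ℕ} {V : Type u}

namespace Protocol

/-- The state of process `p` just before time `i`. -/
def stateAt (P : Protocol n V) (ev : Schedule n V) (p : Fin n) : ℕ → P.State
  | 0 => P.init p
  | i + 1 => if (ev i).1 = p then P.step p (P.stateAt ev p i) (ev i).2 else P.stateAt ev p i

/-- At time `i`, process `p` begins a new round by sending `m` to all processes. -/
def BeginsRound (P : Protocol n V) (ev : Schedule n V) (p : Fin n) (m : Msg n V) (i : ℕ) : Prop :=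
  ev i = (p, .poll) ∧ P.send p (P.stateAt ev p i) = some m

open Classical in
/-- At time `i`, process `p` begins its round number `r` by sending `m` to all processes.
The rounds of a process are numbered consecutively, from 1. -/
def Sends (P : Protocol n V) (ev : Schedule n V) (p : Fin n) (r : ℕ) (m : Msg n V) (i : ℕ) :
    Prop :=
  P.BeginsRound ev p m i ∧ r = Nat.count (fun j => ∃ m', P.BeginsRound ev p m' j) i + 1

/-- At time `i`, process `p` delivers `v` with sequence number `k`. -/
def Delivers (P : Protocol n V) (ev : Schedule n V) (p : Fin n) (k : ℕ) (v : V) (i : ℕ) : Prop :=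
  (ev i).1 = p ∧ P.deliver p (P.stateAt ev p i) (ev i).2 = some (k, v)

/-- The protocol does not forge signatures: whatever happens, every signature of another process
in a message sent by `p` occurred in a message that `p` received earlier. -/
def RespectsSignatures (P : Protocol n V) : Prop :=
  ∀ (ev : Schedule n V) (p : Fin n) (m : Msg n V) (i : ℕ), P.BeginsRound ev p m i →
    ∀ (q : Fin n) (x : Msg n V), q ≠ p → m.HasSig q x →
      ∃ j < i, ∃ (q' : Fin n) (r : ℕ) (m' : Msg n V),
        ev j = (p, .receive q' r m') ∧ m'.HasSig q x

end Protocol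

open Classical in
/-- At time `i`, process `s` broadcasts `v`, as its `k`-th broadcast, counted from 1. -/
def Broadcasts (ev : Schedule n V) (s : Fin n) (k : ℕ) (v : V) (i : ℕ) : Prop :=
  ev i = (s, .broadcast v) ∧ k = Nat.count (fun j => ∃ v', ev j = (s, .broadcast v')) i + 1

/-! ## Communication assumptions, with `B` the set of Byzantine processes -/

/-- Asynchronous rounds: what is received from a correct process was sent by it earlier,
in the indicated round; what a correct process sends is eventually received by
all correct processes; every round of a correct process eventually finishes, so that the
process gets (again and again) the opportunity to begin its next round. -/
structure AsyncRounds (P : Protocol n V) (B : Finset (Fin n)) (ev : Schedule n V) : Prop where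
  authentic : ∀ (p q : Fin n) (r : ℕ) (m : Msg n V) (i : ℕ), p ∉ B → q ∉ B →
    ev i = (p, .receive q r m) → ∃ j < i, P.Sends ev q r m j
  eventual_delivery : ∀ (p q : Fin n) (r : ℕ) (m : Msg n V) (i : ℕ), p ∉ B → q ∉ B →
    P.Sends ev q r m i → ∃ j, ev j = (p, .receive q r m)
  rounds_finish : ∀ p : Fin n, p ∉ B → ∀ i, ∃ j ≥ i, ev j = (p, .poll)

/-- Process `p` receives the message `m` sent by `q` in round `r` before the beginning of the
next round of `p`, that is, before `p` begins its round `r + 1` (if it ever does). -/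
def ReceivedBeforeNextRound (P : Protocol n V) (ev : Schedule n V) (p q : Fin n) (r : ℕ)
    (m : Msg n V) : Prop :=
  ∃ i, ev i = (p, .receive q r m) ∧ ∀ (m' : Msg n V) (j : ℕ), P.Sends ev p (r + 1) m' j → i < j

/-- Unidirectional communication: if two correct processes both send in round `r`, at least one
of them receives the other's message before the beginning of its own next round. -/
def Unidirectional (P : Protocol n V) (B : Finset (Fin n)) (ev : Schedule n V) : Prop :=
  ∀ (p q : Fin n) (r : ℕ) (m m' : Msg n V) (i i' : ℕ), p ∉ B → q ∉ B → p ≠ q →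
    P.Sends ev p r m i → P.Sends ev q r m' i' →
      ReceivedBeforeNextRound P ev p q r m' ∨ ReceivedBeforeNextRound P ev q p r m

/-- Unforgeability: a message from a Byzantine process may be arbitrary, except that each
signature of a correct process `c` in it was issued by `c` in a message that `c` sent earlier.
(Byzantine processes may collude, and see at once whatever a correct process sends.) -/
def Unforgeable (P : Protocol n V) (B : Finset (Fin n)) (ev : Schedule n V) : Prop :=
  ∀ (p b : Fin n) (r : ℕ) (m : Msg n V) (i : ℕ), p ∉ B → b ∈ B → ev i = (p, .receive b r m) →
    ∀ (c : Fin n) (x : Msg n V), c ∉ B → m.HasSig c x →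
      ∃ j < i, ∃ (r' : ℕ) (m' : Msg n V), P.Sends ev c r' m' j ∧ m'.HasSig c x

/-- The executions of `P` with designated sender `s` and set `B` of Byzantine processes, in an
asynchronous system with unidirectional communication and unforgeable signatures. -/
structure IsExecution (P : Protocol n V) (B : Finset (Fin n)) (s : Fin n) (ev : Schedule n V) :
    Prop where
  only_sender_broadcasts : ∀ (p : Fin n) (v : V) (i : ℕ), p ∉ B →
    ev i = (p, .broadcast v) → p = s
  rounds : AsyncRounds P B ev
  unidirectional : Unidirectional P B ev
  unforgeable : Unforgeable P B ev

/-! ## Sequenced reliable broadcast -/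

/-- The properties of sequenced reliable broadcast with sender `s`, in one execution. -/
structure IsSRB (P : Protocol n V) (B : Finset (Fin n)) (s : Fin n) (ev : Schedule n V) :
    Prop where
  /-- If the sender is correct, all correct processes eventually deliver all its broadcasts,
  each with its sequence number. -/
  validity : s ∉ B → ∀ (k : ℕ) (v : V) (i : ℕ), Broadcasts ev s k v i →
    ∀ p : Fin n, p ∉ B → ∃ j, P.Delivers ev p k v j
  /-- What one correct process delivers, all correct processes deliver, with the same number. -/
  agreement : ∀ (q : Fin n) (k : ℕ) (v : V) (i : ℕ), q ∉ B → P.Delivers ev q k v i →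
    ∀ p : Fin n, p ∉ B → ∃ j, P.Delivers ev p k v j
  /-- Deliveries happen in the order of the sequence numbers 1, 2, …, without gaps. -/
  sequencing : ∀ (q : Fin n) (k : ℕ) (v : V) (i : ℕ), q ∉ B → P.Delivers ev q k v i →
    1 ≤ k ∧ ∀ k', 1 ≤ k' → k' < k → ∃ j < i, ∃ v' : V, P.Delivers ev q k' v' j
  /-- What a correct process delivers from a correct sender was broadcast earlier by the sender,
  with that sequence number. -/
  integrity : s ∉ B → ∀ (q : Fin n) (k : ℕ) (v : V) (i : ℕ), q ∉ B → P.Delivers ev q k v i →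
    ∃ j < i, Broadcasts ev s k v j
  /-- A correct process delivers at most once with each sequence number. -/
  unique : ∀ (q : Fin n) (k : ℕ) (v v' : V) (i i' : ℕ), q ∉ B →
    P.Delivers ev q k v i → P.Delivers ev q k v' i' → i = i'

/-- `P` solves sequenced reliable broadcast with sender `s` from unidirectional communication and
signatures, whichever (at most) `t` processes are Byzantine. -/
def SolvesSRB (P : Protocol n V) (t : ℕ) (s : Fin n) : Prop :=
  P.RespectsSignatures ∧
    ∀ B : Finset (Fin n), B.card ≤ t → ∀ ev : Schedule n V, IsExecution P B s ev → IsSRB P B s ev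

end SRB

namespace SRB

variable {n : ℕ} {V : Type u}

/-! ## The protocol

Processes tell each other everything they know. The rounds come in groups of three, one group for
each sequence number `k`. A process begins the first round of the group when it knows a value for
`k` signed by the sender; in the second round it votes for this value, by adding its own signature,
unless it has seen two such values; it begins the third round, and delivers, when it knows `t + 1`
votes for the same value. -/

/-! Everything known is forwarded in every message, so signatures spread, and waiting for knowledge
replaces waiting for processes.

Safety: before voting for `v` in round `3k - 1`, a correct process has sent `v` in round `3k - 2`,
and at the vote it knows no other value. If two correct processes vote, unidirectionality makes one
of them receive the other's value before voting, so the values agree (`Votes.unanimous`). Among `t +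
1` voters one is correct, whence certificates for `k` never conflict (`certifies_unique`).
Signatures of correct processes are genuine (`broadcasts_or_votes_of_know`), which gives integrity.

Liveness: a certificate contains the signed value, so it ends every wait of its group. Whoever
delivers sends its certificate along, and the others catch up by induction on `k`
(`exists_rounds_of_delivers`). A correct sender signs one value for each `k`, so all correct
processes vote for it; there are at least `n - t ≥ t + 1` of them (`exists_rounds_of_broadcasts`).
Sequencing and uniqueness hold because delivery with number `k` is tied to the start of round `3k`.
-/

/-- What the sender signs in order to broadcast `v` with sequence number `k`. -/
def Msg.entry (k : ℕ) (v : V) : Msg n V := .pair (.num k) (.val v)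

@[simp] lemma Msg.not_hasSig_entry (k : ℕ) (v : V) (p : Fin n) (x : Msg n V) :
    ¬ (Msg.entry k v : Msg n V).HasSig p x := by
  simp [Msg.entry, Msg.HasSig]

lemma Msg.entry_inj {k k' : ℕ} {v v' : V} :
    (Msg.entry k v : Msg n V) = .entry k' v' ↔ k = k' ∧ v = v' := by
  simp [Msg.entry]

/-- A signature inside a signed message is inside every message that has the latter. -/
lemma Msg.HasSig.inner {m : Msg n V} {p q : Fin n} {x y : Msg n V}
    (h : m.HasSig p (.signed q y)) (hx : (Msg.signed q y).HasSig q x) : m.HasSig q x := by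
  induction m with
  | empty => exact h.elim
  | num => exact h.elim
  | val => exact h.elim
  | pair a b iha ihb => exact h.imp iha ihb
  | signed r a ih =>
    rcases h with ⟨-, rfl⟩ | h
    · exact Or.inr hx
    · exact Or.inr (ih h)

/-- In `m` there are votes of more than `t` processes for the value `v` of the sender `s` with
sequence number `k`. -/
def Msg.Certifies (m : Msg n V) (t : ℕ) (s : Fin n) (k : ℕ) (v : V) : Prop :=
  ∃ S : Finset (Fin n), t < S.card ∧ ∀ p ∈ S, m.HasSig p (.signed s (.entry k v))

/-- A vote signs the message already signed by the sender, so any single vote carries the sender's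
signature. Hence a certificate also ends the wait for a value. -/
lemma Msg.Certifies.hasSig {m : Msg n V} {t : ℕ} {s : Fin n} {k : ℕ} {v : V}
    (h : m.Certifies t s k v) : m.HasSig s (.entry k v) := by
  obtain ⟨S, hS, h⟩ := h
  obtain ⟨p, hp⟩ := Finset.card_pos.mp (Nat.zero_lt_of_lt hS)
  exact (h p hp).inner (Or.inl ⟨rfl, rfl⟩)

/-- The local state: the number of rounds begun, the number of values broadcast, and everything
received or signed as a broadcast so far. -/
structure VoteState (n : ℕ) (V : Type u) : Type u where
  rounds : ℕ
  casts : ℕ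
  know : Msg n V

/-! ### Rules of a single state -/

namespace VoteState

/-- The sequence number that the next round is concerned with. -/
def seq (σ : VoteState n V) : ℕ := σ.rounds / 3 + 1

open Classical in
/-- The message of the next round, if it can be begun. -/
noncomputable def send (t : ℕ) (s p : Fin n) (σ : VoteState n V) : Option (Msg n V) :=
  if σ.rounds % 3 = 0 then
    if ∃ v, σ.know.HasSig s (.entry σ.seq v) then some σ.know else none
  else if σ.rounds % 3 = 1 then
    if h : ∃! v, σ.know.HasSig s (.entry σ.seq v) then
      some (.pair (.signed p (.signed s (.entry σ.seq h.choose))) σ.know)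
    else some σ.know
  else if ∃ v, σ.know.Certifies t s σ.seq v then some σ.know else none

open Classical in
/-- The delivery that occurs at a poll. -/
noncomputable def deliver (t : ℕ) (s : Fin n) (σ : VoteState n V) : Option (ℕ × V) :=
  if h : σ.rounds % 3 = 2 ∧ ∃ v, σ.know.Certifies t s σ.seq v then some (σ.seq, h.2.choose)
  else none

/-- The state change at a local event. -/
noncomputable def step (t : ℕ) (s p : Fin n) (σ : VoteState n V) : LocalEvent n V → VoteState n V
  | .broadcast v =>
    { σ with casts := σ.casts + 1, know := .pair (.signed p (.entry (σ.casts + 1) v)) σ.know }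
  | .receive _ _ m => { σ with know := .pair m σ.know }
  | .poll => if (σ.send t s p).isSome then { σ with rounds := σ.rounds + 1 } else σ

lemma send_phase_zero {t : ℕ} {s p : Fin n} {σ : VoteState n V} {m : Msg n V}
    (h0 : σ.rounds % 3 = 0) (h : σ.send t s p = some m) :
    m = σ.know ∧ ∃ v, σ.know.HasSig s (.entry σ.seq v) := by
  rw [send, if_pos h0] at h
  split_ifs at h with hv
  cases h
  exact ⟨rfl, hv⟩

lemma send_phase_one {t : ℕ} {s p : Fin n} {σ : VoteState n V} {m : Msg n V} {v : V}
    (h1 : σ.rounds % 3 = 1) (h : σ.send t s p = some m)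
    (hv : σ.know.HasSig s (.entry σ.seq v))
    (hu : ∀ w, σ.know.HasSig s (.entry σ.seq w) → w = v) :
    m.HasSig p (.signed s (.entry σ.seq v)) := by
  have hex : ∃! v, σ.know.HasSig s (.entry σ.seq v) := ⟨v, hv, hu⟩
  have hc : hex.choose = v := hu _ hex.choose_spec.1
  rw [send, if_neg (by omega), if_pos h1, dif_pos hex, hc] at h
  cases h
  exact Or.inl (Or.inl ⟨rfl, rfl⟩)

lemma send_phase_two {t : ℕ} {s p : Fin n} {σ : VoteState n V} {m : Msg n V}
    (h2 : σ.rounds % 3 = 2) (h : σ.send t s p = some m) :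
    m = σ.know ∧ ∃ v, σ.know.Certifies t s σ.seq v := by
  rw [send, if_neg (by omega), if_neg (by omega)] at h
  split_ifs at h with hv
  cases h
  exact ⟨rfl, hv⟩

/-- Each signature in a message that is sent is known or belongs to a vote of the process. -/
lemma hasSig_of_send {t : ℕ} {s p q : Fin n} {σ : VoteState n V} {m x : Msg n V}
    (h : σ.send t s p = some m) (hx : m.HasSig q x) :
    σ.know.HasSig q x ∨ q = p ∧ σ.rounds % 3 = 1 ∧ ∃ v, x = .signed s (.entry σ.seq v) ∧
      σ.know.HasSig s (.entry σ.seq v) ∧ ∀ w, σ.know.HasSig s (.entry σ.seq w) → w = v := by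
  by_cases h1 : σ.rounds % 3 = 1
  · by_cases hex : ∃! v, σ.know.HasSig s (.entry σ.seq v)
    · rw [send, if_neg (by omega), if_pos h1, dif_pos hex] at h
      cases h
      rcases hx with (⟨rfl, rfl⟩ | ⟨rfl, rfl⟩ | hx) | hx
      · exact Or.inr ⟨rfl, h1, _, rfl, hex.choose_spec⟩
      · exact Or.inl hex.choose_spec.1
      · exact absurd hx (Msg.not_hasSig_entry _ _ _ _)
      · exact Or.inl hx
    · rw [send, if_neg (by omega), if_pos h1, dif_neg hex] at h
      cases h
      exact Or.inl hx
  · left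
    rw [send, if_neg h1] at h
    split_ifs at h
    all_goals
      cases h
      exact hx

lemma know_of_send {t : ℕ} {s p q : Fin n} {σ : VoteState n V} {m x : Msg n V}
    (h : σ.send t s p = some m) (hx : σ.know.HasSig q x) : m.HasSig q x := by
  unfold send at h
  split_ifs at h
  all_goals
    cases h
    first
      | exact hx
      | exact Or.inr hx

lemma exists_send_of_certifies {t : ℕ} {s : Fin n} (p : Fin n) {σ : VoteState n V} {v : V}
    (h : σ.know.Certifies t s σ.seq v) : ∃ m, σ.send t s p = some m := by
  have h' := h.hasSig
  unfold send
  split_ifs with _ h1 _ _ h2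
  all_goals
    first
      | exact ⟨_, rfl⟩
      | exact absurd ⟨v, h'⟩ h1
      | exact absurd ⟨v, h⟩ h2

lemma exists_send_of_hasSig {t : ℕ} {s : Fin n} (p : Fin n) {σ : VoteState n V} {v : V}
    (h2 : σ.rounds % 3 ≠ 2) (h : σ.know.HasSig s (.entry σ.seq v)) :
    ∃ m, σ.send t s p = some m := by
  unfold send
  split_ifs with _ h1
  all_goals
    first
      | exact ⟨_, rfl⟩
      | exact absurd ⟨v, h⟩ h1
      | omega

lemma exists_deliver {t : ℕ} {s p : Fin n} {σ : VoteState n V} {m : Msg n V}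
    (h2 : σ.rounds % 3 = 2) (h : σ.send t s p = some m) :
    ∃ v, σ.deliver t s = some (σ.seq, v) := by
  rw [deliver, dif_pos ⟨h2, (send_phase_two h2 h).2⟩]
  exact ⟨_, rfl⟩

/-- `rounds` counts the rounds already begun, so delivery with number `k` at the start of round `3k`
sees the counter at `3k - 1`. -/
lemma deliver_eq_some {t : ℕ} {s : Fin n} {σ : VoteState n V} {k : ℕ} {v : V}
    (h : σ.deliver t s = some (k, v)) :
    σ.rounds + 1 = 3 * k ∧ σ.seq = k ∧ σ.know.Certifies t s k v := by
  unfold deliver at h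
  split_ifs at h with h2
  cases h
  refine ⟨?_, rfl, h2.2.choose_spec⟩
  have := h2.1
  unfold seq
  omega

end VoteState

/-- The protocol in which processes vote for the values signed by the sender `s`. -/
noncomputable def voteProtocol (V : Type u) (t : ℕ) (s : Fin n) : Protocol n V where
  State := VoteState n V
  init _ := ⟨0, 0, .empty⟩
  step p σ e := σ.step t s p e
  send p σ := σ.send t s p
  deliver _ σ
    | .poll => σ.deliver t s
    | _ => none

/-- The state of `p` just before time `i` when the voting protocol is run. -/
noncomputable def voteState (t : ℕ) (s : Fin n) (ev : Schedule n V) (p : Fin n) (i : ℕ) :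
    VoteState n V :=
  (voteProtocol V t s).stateAt ev p i

/-! ### Evolution of one process under an arbitrary schedule -/

section Local

variable {t : ℕ} {s : Fin n} {ev : Schedule n V} {p : Fin n}

lemma voteState_succ_self {i : ℕ} {e : LocalEvent n V} (h : ev i = (p, e)) :
    voteState t s ev p (i + 1) = (voteState t s ev p i).step t s p e := by
  have h1 : (ev i).1 = p := by rw [h]
  have h2 : (ev i).2 = e := by rw [h]
  rw [← h2]
  exact if_pos h1

lemma voteState_succ_other {i : ℕ} (h : (ev i).1 ≠ p) :
    voteState t s ev p (i + 1) = voteState t s ev p i :=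
  if_neg h

lemma beginsRound_iff {m : Msg n V} {i : ℕ} :
    (voteProtocol V t s).BeginsRound ev p m i ↔
      ev i = (p, .poll) ∧ (voteState t s ev p i).send t s p = some m :=
  Iff.rfl

lemma rounds_succ_of_beginsRound {m : Msg n V} {i : ℕ}
    (h : (voteProtocol V t s).BeginsRound ev p m i) :
    (voteState t s ev p (i + 1)).rounds = (voteState t s ev p i).rounds + 1 := by
  rw [beginsRound_iff] at h
  simp [voteState_succ_self h.1, VoteState.step, h.2]

lemma rounds_succ_of_not_beginsRound {i : ℕ}
    (h : ¬ ∃ m, (voteProtocol V t s).BeginsRound ev p m i) :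
    (voteState t s ev p (i + 1)).rounds = (voteState t s ev p i).rounds := by
  by_cases hp : (ev i).1 = p
  · obtain ⟨e, he⟩ : ∃ e, ev i = (p, e) := ⟨(ev i).2, Prod.ext hp rfl⟩
    rw [voteState_succ_self he]
    cases e with
    | broadcast v => rfl
    | receive q r m => rfl
    | poll =>
      have : ¬ ((voteState t s ev p i).send t s p).isSome := fun hs =>
        h ((Option.isSome_iff_exists.mp hs).imp fun m hm => ⟨he, hm⟩)
      simp [VoteState.step, this]
  · rw [voteState_succ_other hp]

open Classical in
lemma rounds_eq_count (i : ℕ) : (voteState t s ev p i).rounds =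
    Nat.count (fun j => ∃ m, (voteProtocol V t s).BeginsRound ev p m j) i := by
  induction i with
  | zero => rfl
  | succ i ih =>
    rw [Nat.count_succ]
    split_ifs with h
    · obtain ⟨m, hm⟩ := h
      rw [rounds_succ_of_beginsRound hm, ih]
    · rw [rounds_succ_of_not_beginsRound h, ih, add_zero]

lemma sends_iff {m : Msg n V} {i r : ℕ} : (voteProtocol V t s).Sends ev p r m i ↔
    (voteProtocol V t s).BeginsRound ev p m i ∧ r = (voteState t s ev p i).rounds + 1 := by
  rw [rounds_eq_count]
  rfl

open Classical in
lemma casts_eq_count (i : ℕ) :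
    (voteState t s ev p i).casts = Nat.count (fun j => ∃ v, ev j = (p, .broadcast v)) i := by
  induction i with
  | zero => rfl
  | succ i ih =>
    rw [Nat.count_succ]
    by_cases hp : (ev i).1 = p
    · obtain ⟨e, he⟩ : ∃ e, ev i = (p, e) := ⟨(ev i).2, Prod.ext hp rfl⟩
      rw [voteState_succ_self he, ← ih, he]
      cases e with
      | broadcast v => simp [VoteState.step]
      | receive q r m => simp [VoteState.step]
      | poll =>
        simp only [VoteState.step]
        split_ifs <;> simp_all
    · rw [voteState_succ_other hp, if_neg, ih, add_zero]
      rintro ⟨v, hv⟩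
      exact hp (by rw [hv])

lemma broadcasts_iff {k i : ℕ} {v : V} : Broadcasts ev s k v i ↔
    ev i = (s, .broadcast v) ∧ k = (voteState t s ev s i).casts + 1 := by
  rw [casts_eq_count]
  rfl

open Classical in
-- The number of a broadcast determines its time, since a count is injective on the times it counts.
lemma Broadcasts.inj {k i i' : ℕ} {v v' : V} (h : Broadcasts ev s k v i)
    (h' : Broadcasts ev s k v' i') : v = v' := by
  have hi : i = i' := Nat.count_injective (p := fun j => ∃ v', ev j = (s, .broadcast v'))
    ⟨v, h.1⟩ ⟨v', h'.1⟩ (by have := h.2; have := h'.2; omega)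
  subst hi
  have := h.1.symm.trans h'.1
  simpa using this

open Classical in
lemma Broadcasts.exists_of_le {k k' i : ℕ} {v : V} (h : Broadcasts ev s k v i) (h1 : 1 ≤ k')
    (hk : k' ≤ k) : ∃ v' i', Broadcasts ev s k' v' i' := by
  let P : ℕ → Prop := fun j => ∃ v', ev j = (s, .broadcast v')
  have hlt : k' - 1 < Nat.count P (i + 1) := by
    rw [Nat.count_succ, if_pos (show P i from ⟨v, h.1⟩)]
    have : k = Nat.count P i + 1 := h.2
    omega
  -- `Nat.nth` takes a default value past the last element of a finite set; this bound excludes that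
  -- case. Its index is zero-based, hence `k' - 1`.
  have hfin : ∀ hf : (Set.ofPred P).Finite, k' - 1 < hf.toFinset.card := fun hf =>
    hlt.trans_le (Nat.count_le_card hf _)
  obtain ⟨v', hv'⟩ : P (Nat.nth P (k' - 1)) := Nat.nth_mem _ hfin
  refine ⟨v', Nat.nth P (k' - 1), hv', ?_⟩
  have : Nat.count P (Nat.nth P (k' - 1)) = k' - 1 := Nat.count_nth hfin
  change k' = Nat.count P _ + 1
  omega

lemma rounds_mono : Monotone fun i => (voteState t s ev p i).rounds := by
  classical
  simp only [rounds_eq_count]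
  exact Nat.count_monotone _

/-- New signatures have two sources, an own broadcast and a received message. An own vote is not
recorded in `know`; it comes back only as a received message. -/
lemma know_succ {i : ℕ} {q : Fin n} {x : Msg n V}
    (h : (voteState t s ev p (i + 1)).know.HasSig q x) :
    (voteState t s ev p i).know.HasSig q x ∨
      (∃ v, ev i = (p, .broadcast v) ∧ q = p ∧
        x = .entry ((voteState t s ev p i).casts + 1) v) ∨
      ∃ q' r m, ev i = (p, .receive q' r m) ∧ m.HasSig q x := by
  by_cases hp : (ev i).1 = p
  · obtain ⟨e, he⟩ : ∃ e, ev i = (p, e) := ⟨(ev i).2, Prod.ext hp rfl⟩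
    rw [voteState_succ_self he] at h
    cases e with
    | broadcast v =>
      rcases h with (⟨rfl, rfl⟩ | h) | h
      · exact Or.inr (Or.inl ⟨v, he, rfl, rfl⟩)
      · exact absurd h (Msg.not_hasSig_entry _ _ _ _)
      · exact Or.inl h
    | receive q' r m =>
      rcases h with h | h
      · exact Or.inr (Or.inr ⟨q', r, m, he, h⟩)
      · exact Or.inl h
    | poll =>
      left
      simp only [VoteState.step] at h
      split_ifs at h <;> exact h
  · rw [voteState_succ_other hp] at h
    exact Or.inl h

lemma know_mono {i j : ℕ} (hij : i ≤ j) {q : Fin n} {x : Msg n V}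
    (h : (voteState t s ev p i).know.HasSig q x) : (voteState t s ev p j).know.HasSig q x := by
  induction j, hij using Nat.le_induction with
  | base => exact h
  | succ j _ ih =>
    by_cases hp : (ev j).1 = p
    · obtain ⟨e, he⟩ : ∃ e, ev j = (p, e) := ⟨(ev j).2, Prod.ext hp rfl⟩
      rw [voteState_succ_self he]
      cases e with
      | broadcast v => exact Or.inr ih
      | receive q' r m => exact Or.inr ih
      | poll =>
        simp only [VoteState.step]
        split_ifs <;> exact ih
    · rwa [voteState_succ_other hp]

lemma certifies_mono {i j k : ℕ} {v : V} (hij : i ≤ j)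
    (h : (voteState t s ev p i).know.Certifies t s k v) :
    (voteState t s ev p j).know.Certifies t s k v :=
  h.imp fun _ hS => ⟨hS.1, fun q hq => know_mono hij (hS.2 q hq)⟩

lemma know_of_receive {i j r : ℕ} {q q' : Fin n} {m x : Msg n V} (h : ev i = (p, .receive q r m))
    (hx : m.HasSig q' x) (hij : i < j) : (voteState t s ev p j).know.HasSig q' x := by
  refine know_mono (Nat.succ_le_of_lt hij) ?_
  rw [voteState_succ_self h]
  exact Or.inl hx

lemma know_of_broadcasts {i k : ℕ} {v : V} (h : Broadcasts ev s k v i) :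
    (voteState t s ev s (i + 1)).know.HasSig s (.entry k v) := by
  obtain ⟨he, rfl⟩ := (broadcasts_iff (t := t)).mp h
  rw [voteState_succ_self he]
  exact Or.inl (Or.inl ⟨rfl, rfl⟩)

/-- A process that has begun more than `c` rounds did so with round `c + 1`. -/
lemma exists_beginsRound {c i : ℕ} (h : c < (voteState t s ev p i).rounds) :
    ∃ j < i, ∃ m, (voteProtocol V t s).BeginsRound ev p m j ∧
      (voteState t s ev p j).rounds = c := by
  induction i with
  | zero => exact absurd h (Nat.not_lt_zero _)
  | succ i ih =>
    by_cases hi : c < (voteState t s ev p i).rounds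
    · obtain ⟨j, hj, hm⟩ := ih hi
      exact ⟨j, hj.trans i.lt_succ_self, hm⟩
    · by_cases hb : ∃ m, (voteProtocol V t s).BeginsRound ev p m i
      · obtain ⟨m, hm⟩ := hb
        rw [rounds_succ_of_beginsRound hm] at h
        exact ⟨i, i.lt_succ_self, m, hm, by omega⟩
      · rw [rounds_succ_of_not_beginsRound hb] at h
        exact absurd h hi

lemma delivers_iff {k i : ℕ} {v : V} : (voteProtocol V t s).Delivers ev p k v i ↔
    ev i = (p, .poll) ∧ (voteState t s ev p i).deliver t s = some (k, v) := by
  constructor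
  · rintro ⟨hp, h⟩
    obtain ⟨e, he⟩ : ∃ e, ev i = (p, e) := ⟨(ev i).2, Prod.ext hp rfl⟩
    rw [he] at h
    cases e with
    | broadcast v => cases h
    | receive q r m => cases h
    | poll => exact ⟨he, h⟩
  · rintro ⟨he, h⟩
    refine ⟨by rw [he], ?_⟩
    rw [he]
    exact h

/-- A delivery happens at the beginning of the third round for the sequence number. -/
lemma delivers_beginsRound {k i : ℕ} {v : V} (h : (voteProtocol V t s).Delivers ev p k v i) :
    (voteState t s ev p i).rounds + 1 = 3 * k ∧
      (voteState t s ev p i).know.Certifies t s k v ∧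
      ∃ m, (voteProtocol V t s).BeginsRound ev p m i := by
  obtain ⟨he, h⟩ := delivers_iff.mp h
  obtain ⟨h1, h2, h3⟩ := VoteState.deliver_eq_some h
  obtain ⟨m, hm⟩ := VoteState.exists_send_of_certifies p (h2.symm ▸ h3)
  exact ⟨h1, h3, m, he, hm⟩

/-- A process that has begun all rounds for a sequence number has delivered with it. -/
lemma exists_delivers {k i : ℕ} (hk : 1 ≤ k) (h : 3 * k ≤ (voteState t s ev p i).rounds) :
    ∃ j < i, ∃ v, (voteProtocol V t s).Delivers ev p k v j := by
  obtain ⟨j, hj, m, hm, hr⟩ := exists_beginsRound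
    (show 3 * k - 1 < (voteState t s ev p i).rounds by omega)
  obtain ⟨v, hv⟩ := VoteState.exists_deliver (by omega) (beginsRound_iff.mp hm).2
  refine ⟨j, hj, v, delivers_iff.mpr ⟨hm.1, ?_⟩⟩
  have : (voteState t s ev p j).seq = k := by unfold VoteState.seq; omega
  rw [hv, this]

lemma voteProtocol_respectsSignatures (V : Type u) (t : ℕ) (s : Fin n) :
    (voteProtocol V t s).RespectsSignatures := by
  intro ev p m i hm q x hq hx
  have hknow : (voteState t s ev p i).know.HasSig q x := by
    rcases VoteState.hasSig_of_send (beginsRound_iff.mp hm).2 hx with h | ⟨h, -⟩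
    · exact h
    · exact absurd h hq
  clear hm hx
  induction i with
  | zero => exact hknow.elim
  | succ i ih =>
    rcases know_succ hknow with h | ⟨v, -, h, -⟩ | ⟨q', r, m', he, h⟩
    · obtain ⟨j, hj, h⟩ := ih h
      exact ⟨j, hj.trans i.lt_succ_self, h⟩
    · exact absurd h hq
    · exact ⟨i, i.lt_succ_self, q', r, m', he, h⟩

lemma voteProtocol_sequencing {q : Fin n} {k i : ℕ} {v : V}
    (h : (voteProtocol V t s).Delivers ev q k v i) :
    1 ≤ k ∧ ∀ k', 1 ≤ k' → k' < k →
      ∃ j < i, ∃ v' : V, (voteProtocol V t s).Delivers ev q k' v' j := by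
  have h1 := (delivers_beginsRound h).1
  exact ⟨by omega, fun k' h' hk => exists_delivers h' (by omega)⟩

/-- A delivery with number `k` moves the monotone counter from `3k - 1` to `3k`, which can happen
only once. -/
lemma voteProtocol_unique {q : Fin n} {k i i' : ℕ} {v v' : V}
    (h : (voteProtocol V t s).Delivers ev q k v i)
    (h' : (voteProtocol V t s).Delivers ev q k v' i') : i = i' := by
  obtain ⟨h1, -, m, hm⟩ := delivers_beginsRound h
  obtain ⟨h1', -, m', hm'⟩ := delivers_beginsRound h'
  have a := rounds_succ_of_beginsRound hm
  have a' := rounds_succ_of_beginsRound hm'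
  rcases lt_trichotomy i i' with hi | hi | hi
  · have : (voteState t s ev q (i + 1)).rounds ≤ (voteState t s ev q i').rounds := rounds_mono hi
    omega
  · exact hi
  · have : (voteState t s ev q (i' + 1)).rounds ≤ (voteState t s ev q i).rounds := rounds_mono hi
    omega

/-- At time `i`, process `p` votes for the value `v` of the sender with sequence number `k`. -/
def Votes (t : ℕ) (s : Fin n) (ev : Schedule n V) (p : Fin n) (k : ℕ) (v : V) (i : ℕ) : Prop :=
  (∃ m, (voteProtocol V t s).BeginsRound ev p m i) ∧
    (voteState t s ev p i).rounds + 2 = 3 * k ∧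
    (voteState t s ev p i).know.HasSig s (.entry k v) ∧
    ∀ w, (voteState t s ev p i).know.HasSig s (.entry k w) → w = v

lemma beginsRound_hasSig {q : Fin n} {m x : Msg n V} {i : ℕ}
    (h : (voteProtocol V t s).BeginsRound ev p m i) (hx : m.HasSig q x) :
    (voteState t s ev p i).know.HasSig q x ∨
      q = p ∧ ∃ k v, x = .signed s (.entry k v) ∧ Votes t s ev p k v i := by
  rcases VoteState.hasSig_of_send (beginsRound_iff.mp h).2 hx with h' | ⟨hq, h1, v, hv, h'⟩
  · exact Or.inl h'
  · refine Or.inr ⟨hq, _, v, hv, ⟨m, h⟩, ?_, h'⟩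
    unfold VoteState.seq
    omega

end Local

/-! ### Safety: genuine signatures and unanimous votes -/

section Execution

variable {t : ℕ} {s : Fin n} {ev : Schedule n V} {B : Finset (Fin n)}

/-- The signatures of correct processes that are known to correct processes are genuine. -/
lemma broadcasts_or_votes_of_know (hE : IsExecution (voteProtocol V t s) B s ev) {c : Fin n}
    (hc : c ∉ B) {x : Msg n V} (i : ℕ) {p : Fin n} (hp : p ∉ B)
    (h : (voteState t s ev p i).know.HasSig c x) :
    ∃ j < i, ∃ k v, c = s ∧ x = .entry k v ∧ Broadcasts ev s k v j ∨
      x = .signed s (.entry k v) ∧ Votes t s ev c k v j := by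
  -- A received signature is traced to the state of another process at an arbitrary earlier time,
  -- hence strong induction over all correct `p`.
  induction i using Nat.strong_induction_on generalizing p with
  | _ i ih =>
    have key : ∀ j < i, ∀ q ∉ B, ∀ r m, (voteProtocol V t s).Sends ev q r m j → m.HasSig c x →
        ∃ j < i, ∃ k v, c = s ∧ x = .entry k v ∧ Broadcasts ev s k v j ∨
          x = .signed s (.entry k v) ∧ Votes t s ev c k v j := by
      intro j hj q hq r m hm hx
      rcases beginsRound_hasSig hm.1 hx with h | ⟨rfl, k, v, h⟩
      · obtain ⟨j', hj', h⟩ := ih j hj hq h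
        exact ⟨j', hj'.trans hj, h⟩
      · exact ⟨j, hj, k, v, Or.inr h⟩
    cases i with
    | zero => exact h.elim
    | succ i =>
      rcases know_succ h with h | ⟨v, he, rfl, rfl⟩ | ⟨q, r, m, he, h⟩
      · obtain ⟨j, hj, h⟩ := ih i i.lt_succ_self hp h
        exact ⟨j, hj.trans i.lt_succ_self, h⟩
      · obtain rfl := hE.only_sender_broadcasts _ v i hp he
        exact ⟨i, i.lt_succ_self, _, v, Or.inl ⟨rfl, rfl, broadcasts_iff.mpr ⟨he, rfl⟩⟩⟩
      · by_cases hq : q ∈ B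
        · obtain ⟨j, hj, r', m', hm', h⟩ := hE.unforgeable p q r m i hp hq he c x hc h
          exact key j (hj.trans i.lt_succ_self) c hc r' m' hm' h
        · obtain ⟨j, hj, hm⟩ := hE.rounds.authentic p q r m i hp hq he
          exact key j (hj.trans i.lt_succ_self) q hq r m hm h

lemma broadcasts_of_know (hE : IsExecution (voteProtocol V t s) B s ev) (hs : s ∉ B)
    {p : Fin n} (hp : p ∉ B) {k i : ℕ} {v : V}
    (h : (voteState t s ev p i).know.HasSig s (.entry k v)) : ∃ j < i, Broadcasts ev s k v j := by
  obtain ⟨j, hj, k', v', ⟨-, hx, hb⟩ | ⟨hx, -⟩⟩ := broadcasts_or_votes_of_know hE hs i hp h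
  · obtain ⟨rfl, rfl⟩ := Msg.entry_inj.mp hx
    exact ⟨j, hj, hb⟩
  · cases hx

lemma votes_of_know (hE : IsExecution (voteProtocol V t s) B s ev) {c p : Fin n} (hc : c ∉ B)
    (hp : p ∉ B) {k i : ℕ} {v : V}
    (h : (voteState t s ev p i).know.HasSig c (.signed s (.entry k v))) :
    ∃ j, Votes t s ev c k v j := by
  obtain ⟨j, -, k', v', ⟨-, hx, -⟩ | ⟨hx, hv⟩⟩ := broadcasts_or_votes_of_know hE hc i hp h
  · cases hx
  · obtain ⟨-, hx⟩ := Msg.signed.inj hx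
    obtain ⟨rfl, rfl⟩ := Msg.entry_inj.mp hx
    exact ⟨j, hv⟩

/-- A process that votes for a value sent it in the round before. -/
lemma Votes.exists_sends {p : Fin n} {k i : ℕ} {v : V} (h : Votes t s ev p k v i) :
    ∃ j m, (voteProtocol V t s).Sends ev p (3 * k - 2) m j ∧ m.HasSig s (.entry k v) := by
  obtain ⟨-, hr, -, hu⟩ := h
  obtain ⟨j, hj, m, hm, hc⟩ := exists_beginsRound
    (show 3 * k - 3 < (voteState t s ev p i).rounds by omega)
  have hseq : (voteState t s ev p j).seq = k := by unfold VoteState.seq; omega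
  obtain ⟨rfl, w, hw⟩ := VoteState.send_phase_zero (by omega) (beginsRound_iff.mp hm).2
  rw [hseq] at hw
  -- The value known in the first round is still known at the vote, where only `v` is known.
  obtain rfl := hu w (know_mono hj.le hw)
  exact ⟨j, _, sends_iff.mpr ⟨hm, by omega⟩, hw⟩

/-- The vote itself begins round `3k - 1`, so a message of round `3k - 2` received before that is
already known when the vote is cast. -/
lemma Votes.eq_of_received {p q : Fin n} {k i : ℕ} {v w : V} {m : Msg n V}
    (h : Votes t s ev p k v i) (hm : m.HasSig s (.entry k w))
    (hr : ReceivedBeforeNextRound (voteProtocol V t s) ev p q (3 * k - 2) m) : w = v := by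
  obtain ⟨⟨m', hm'⟩, hc, -, hu⟩ := h
  obtain ⟨j, hj, hlt⟩ := hr
  exact hu w (know_of_receive hj hm (hlt m' i (sends_iff.mpr ⟨hm', by omega⟩)))

/-- Correct processes do not vote for different values with the same sequence number. -/
lemma Votes.unanimous (hE : IsExecution (voteProtocol V t s) B s ev) {p q : Fin n} (hp : p ∉ B)
    (hq : q ∉ B) {k i j : ℕ} {v w : V} (h : Votes t s ev p k v i) (h' : Votes t s ev q k w j) :
    v = w := by
  by_cases hpq : p = q
  · subst hpq
    rcases le_total i j with hij | hij
    · exact h'.2.2.2 v (know_mono hij h.2.2.1)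
    · exact (h.2.2.2 w (know_mono hij h'.2.2.1)).symm
  · obtain ⟨a, m, hm, hx⟩ := h.exists_sends
    obtain ⟨a', m', hm', hx'⟩ := h'.exists_sends
    -- Both voters sent their value in round `3k - 2`; whichever received the other's message in
    -- time would have seen a conflict.
    rcases hE.unidirectional p q _ m m' a a' hp hq hpq hm hm' with hr | hr
    · exact (h.eq_of_received hx' hr).symm
    · exact h'.eq_of_received hx hr

lemma exists_votes_of_certifies (hE : IsExecution (voteProtocol V t s) B s ev)
    (hB : B.card ≤ t) {p : Fin n} (hp : p ∉ B) {k i : ℕ} {v : V}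
    (h : (voteState t s ev p i).know.Certifies t s k v) :
    ∃ c ∉ B, ∃ j, Votes t s ev c k v j := by
  obtain ⟨S, hS, h⟩ := h
  obtain ⟨c, hcS, hc⟩ := Finset.exists_mem_notMem_of_card_lt_card (hB.trans_lt hS)
  exact ⟨c, hc, votes_of_know hE hc hp (h c hcS)⟩

lemma certifies_unique (hE : IsExecution (voteProtocol V t s) B s ev) (hB : B.card ≤ t)
    {p q : Fin n} (hp : p ∉ B) (hq : q ∉ B) {k i j : ℕ} {v w : V}
    (h : (voteState t s ev p i).know.Certifies t s k v)
    (h' : (voteState t s ev q j).know.Certifies t s k w) : v = w := by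
  obtain ⟨c, hc, a, ha⟩ := exists_votes_of_certifies hE hB hp h
  obtain ⟨c', hc', a', ha'⟩ := exists_votes_of_certifies hE hB hq h'
  exact ha.unanimous hE hc hc' ha'

/-! ### Liveness: progress through the rounds -/

/-- If a correct process is able to begin its round `c + 1` from some time on, it does so. -/
lemma exists_rounds_gt (hE : IsExecution (voteProtocol V t s) B s ev) {p : Fin n} (hp : p ∉ B)
    {c i : ℕ} (hc : c ≤ (voteState t s ev p i).rounds)
    (h : ∀ j ≥ i, (voteState t s ev p j).rounds = c →
      ∃ m, (voteState t s ev p j).send t s p = some m) :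
    ∃ j ≥ i, c < (voteState t s ev p j).rounds := by
  obtain ⟨j, hij, hj⟩ := hE.rounds.rounds_finish p hp i
  have hcj : c ≤ (voteState t s ev p j).rounds := hc.trans (rounds_mono hij)
  rcases hcj.lt_or_eq with hlt | heq
  · exact ⟨j, hij, hlt⟩
  · obtain ⟨m, hm⟩ := h j hij heq.symm
    have := rounds_succ_of_beginsRound (beginsRound_iff.mpr ⟨hj, hm⟩)
    exact ⟨j + 1, by omega, by omega⟩

/-- The first two rounds for a sequence number are begun once a value is known. -/
lemma exists_rounds_of_hasSig (hE : IsExecution (voteProtocol V t s) B s ev) {p : Fin n}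
    (hp : p ∉ B) {k i : ℕ} {v : V} (hc : 3 * k ≤ (voteState t s ev p i).rounds)
    (h : (voteState t s ev p i).know.HasSig s (.entry (k + 1) v)) :
    ∃ j ≥ i, 3 * k + 2 ≤ (voteState t s ev p j).rounds := by
  have able : ∀ c, 3 * k ≤ c → c < 3 * k + 2 → ∀ j ≥ i, (voteState t s ev p j).rounds = c →
      ∃ m, (voteState t s ev p j).send t s p = some m := by
    intro c h1 h2 j hj hr
    have hseq : (voteState t s ev p j).seq = k + 1 := by unfold VoteState.seq; omega
    exact VoteState.exists_send_of_hasSig p (by omega) (hseq.symm ▸ know_mono hj h)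
  obtain ⟨j, hj, h1⟩ := exists_rounds_gt hE hp hc (able _ le_rfl (by omega))
  obtain ⟨j', hj', h2⟩ := exists_rounds_gt hE hp (Nat.succ_le_of_lt h1)
    fun a ha => able _ (by omega) (by omega) a (hj.trans ha)
  exact ⟨j', hj.trans hj', h2⟩

/-- All rounds for a sequence number are begun once a value is certified. -/
lemma exists_rounds_of_certifies (hE : IsExecution (voteProtocol V t s) B s ev) {p : Fin n}
    (hp : p ∉ B) {k i : ℕ} {v : V} (hc : 3 * k ≤ (voteState t s ev p i).rounds)
    (h : (voteState t s ev p i).know.Certifies t s (k + 1) v) :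
    ∃ j, 3 * (k + 1) ≤ (voteState t s ev p j).rounds := by
  obtain ⟨j, hj, h1⟩ := exists_rounds_of_hasSig hE hp hc h.hasSig
  obtain ⟨j', -, h2⟩ := exists_rounds_gt hE hp h1 fun a ha hr => by
    have hseq : (voteState t s ev p a).seq = k + 1 := by unfold VoteState.seq; omega
    exact VoteState.exists_send_of_certifies p
      (hseq.symm ▸ certifies_mono (hj.trans ha) h)
  exact ⟨j', h2⟩

lemma eventually_know_of_beginsRound (hE : IsExecution (voteProtocol V t s) B s ev)
    {p q : Fin n} (hp : p ∉ B) (hq : q ∉ B) {i : ℕ} {m : Msg n V}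
    (h : (voteProtocol V t s).BeginsRound ev q m i) :
    ∃ j, ∀ c x, m.HasSig c x → (voteState t s ev p j).know.HasSig c x := by
  obtain ⟨j, hj⟩ := hE.rounds.eventual_delivery p q _ m i hp hq (sends_iff.mpr ⟨h, rfl⟩)
  exact ⟨j + 1, fun c x hx => know_of_receive hj hx j.lt_succ_self⟩

/-- The message with which `q` begins the third round of a group contains its certificate, which
reaches `p` and lets `p` complete that group too. -/
lemma exists_rounds_of_delivers (hE : IsExecution (voteProtocol V t s) B s ev) {p q : Fin n}
    (hp : p ∉ B) (hq : q ∉ B) (k : ℕ) {i : ℕ} (h : 3 * k ≤ (voteState t s ev q i).rounds) :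
    ∃ j, 3 * k ≤ (voteState t s ev p j).rounds := by
  induction k with
  | zero => exact ⟨0, by omega⟩
  | succ k ih =>
    obtain ⟨j, hj⟩ := ih (by omega)
    obtain ⟨a, -, v, hv⟩ := exists_delivers (Nat.le_add_left 1 k) h
    obtain ⟨-, ⟨S, hS, hcert⟩, m, hm⟩ := delivers_beginsRound hv
    obtain ⟨b, hb⟩ := eventually_know_of_beginsRound hE hp hq hm
    refine exists_rounds_of_certifies hE hp (i := max j b) (v := v)
      (hj.trans (rounds_mono (le_max_left _ _))) ⟨S, hS, fun c hc => ?_⟩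
    exact know_mono (le_max_right _ _)
      (hb c _ (VoteState.know_of_send (beginsRound_iff.mp hm).2 (hcert c hc)))

lemma voteProtocol_agreement (hE : IsExecution (voteProtocol V t s) B s ev) (hB : B.card ≤ t)
    {p q : Fin n} (hp : p ∉ B) (hq : q ∉ B) {k i : ℕ} {v : V}
    (h : (voteProtocol V t s).Delivers ev q k v i) :
    ∃ j, (voteProtocol V t s).Delivers ev p k v j := by
  obtain ⟨hr, hcert, m, hm⟩ := delivers_beginsRound h
  -- The delivery begins round `3k`, so the counter shows `3k` only at `i + 1`.
  obtain ⟨j, hj⟩ := exists_rounds_of_delivers hE hp hq k (i := i + 1)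
    (by rw [rounds_succ_of_beginsRound hm]; omega)
  obtain ⟨a, -, w, hw⟩ := exists_delivers (by omega) hj
  obtain rfl := certifies_unique hE hB hp hq (delivers_beginsRound hw).2.1 hcert
  exact ⟨a, hw⟩

lemma voteProtocol_integrity (hE : IsExecution (voteProtocol V t s) B s ev) (hs : s ∉ B)
    {q : Fin n} (hq : q ∉ B) {k i : ℕ} {v : V} (h : (voteProtocol V t s).Delivers ev q k v i) :
    ∃ j < i, Broadcasts ev s k v j :=
  broadcasts_of_know hE hs hq (delivers_beginsRound h).2.1.hasSig

/-- A value broadcast by a correct sender becomes known to a correct process when all earlier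
rounds have been begun by the sender. -/
lemma eventually_know_of_broadcasts (hE : IsExecution (voteProtocol V t s) B s ev) (hs : s ∉ B)
    {p : Fin n} (hp : p ∉ B) {k i j : ℕ} {v : V} (h : Broadcasts ev s (k + 1) v i)
    (hj : 3 * k ≤ (voteState t s ev s j).rounds) :
    ∃ a, (voteState t s ev p a).know.HasSig s (.entry (k + 1) v) := by
  obtain ⟨a, -, ha⟩ := exists_rounds_of_hasSig hE hs (i := max j (i + 1)) (v := v)
    (hj.trans (rounds_mono (le_max_left _ _)))
    (know_mono (le_max_right _ _) (know_of_broadcasts h))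
  obtain ⟨b, -, m, hm, hr⟩ := exists_beginsRound
    (show 3 * k < (voteState t s ev s a).rounds by omega)
  obtain ⟨rfl, w, hw⟩ := VoteState.send_phase_zero (by omega) (beginsRound_iff.mp hm).2
  have hseq : (voteState t s ev s b).seq = k + 1 := by unfold VoteState.seq; omega
  rw [hseq] at hw
  -- The first round may have been begun with some `w`; a correct sender has only one value for `k +
  -- 1`, so `w = v`.
  obtain ⟨b', -, hb'⟩ := broadcasts_of_know hE hs hs hw
  obtain rfl := hb'.inj h
  obtain ⟨d, hd⟩ := eventually_know_of_beginsRound hE hp hs hm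
  exact ⟨d, hd _ _ hw⟩

/-- The vote of a correct process for a value of a correct sender is eventually known. -/
lemma eventually_know_vote (hE : IsExecution (voteProtocol V t s) B s ev) (hs : s ∉ B)
    {p q : Fin n} (hp : p ∉ B) (hq : q ∉ B) {k i j : ℕ} {v : V}
    (h : Broadcasts ev s (k + 1) v i) (hj : 3 * k + 2 ≤ (voteState t s ev q j).rounds) :
    ∃ a, (voteState t s ev p a).know.HasSig q (.signed s (.entry (k + 1) v)) := by
  -- With a correct sender no second value is ever known, so `q` cannot abstain.
  have uniq : ∀ b w, (voteState t s ev q b).know.HasSig s (.entry (k + 1) w) → w = v := by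
    intro b w hw
    obtain ⟨b', -, hb'⟩ := broadcasts_of_know hE hs hq hw
    exact hb'.inj h
  obtain ⟨a, -, m, hm, hr⟩ := exists_beginsRound
    (show 3 * k + 1 < (voteState t s ev q j).rounds by omega)
  obtain ⟨b, hba, m', hm', hr'⟩ := exists_beginsRound
    (show 3 * k < (voteState t s ev q a).rounds by omega)
  obtain ⟨-, w, hw⟩ := VoteState.send_phase_zero (by omega) (beginsRound_iff.mp hm').2
  have hseq : (voteState t s ev q a).seq = k + 1 := by unfold VoteState.seq; omega
  have hseq' : (voteState t s ev q b).seq = k + 1 := by unfold VoteState.seq; omega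
  rw [hseq'] at hw
  obtain rfl := uniq b w hw
  have hx := VoteState.send_phase_one (v := w) (by omega) (beginsRound_iff.mp hm).2
    (hseq.symm ▸ know_mono hba.le hw) (hseq.symm ▸ uniq a)
  rw [hseq] at hx
  obtain ⟨d, hd⟩ := eventually_know_of_beginsRound hE hp hq hm
  exact ⟨d, hd _ _ hx⟩

/-- Once all correct processes have completed the earlier groups, the sender's value reaches each of
them, each votes for it, and their votes form a certificate. -/
lemma exists_rounds_of_broadcasts (hn : 2 * t + 1 ≤ n) (hB : B.card ≤ t)
    (hE : IsExecution (voteProtocol V t s) B s ev) (hs : s ∉ B) (k : ℕ) {i : ℕ} {v : V}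
    (h : Broadcasts ev s k v i) {p : Fin n} (hp : p ∉ B) :
    ∃ j, 3 * k ≤ (voteState t s ev p j).rounds := by
  induction k generalizing i v p with
  | zero => exact ⟨0, by omega⟩
  | succ k ih =>
    have start : ∀ q ∉ B, ∃ j, 3 * k ≤ (voteState t s ev q j).rounds := by
      intro q hq
      -- Broadcasts are numbered from 1, so the induction hypothesis applies only for positive `k`.
      rcases Nat.eq_zero_or_pos k with rfl | hk
      · exact ⟨0, by omega⟩
      · obtain ⟨v', i', h'⟩ := h.exists_of_le hk k.le_succ
        exact ih h' hq
    have voted : ∀ q ∉ B, ∃ a,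
        (voteState t s ev p a).know.HasSig q (.signed s (.entry (k + 1) v)) := by
      intro q hq
      obtain ⟨j, hj⟩ := start s hs
      obtain ⟨a, ha⟩ := eventually_know_of_broadcasts hE hs hq h hj
      obtain ⟨b, hb⟩ := start q hq
      obtain ⟨c, -, hc⟩ := exists_rounds_of_hasSig hE hq (i := max a b)
        (hb.trans (rounds_mono (le_max_right _ _))) (know_mono (le_max_left _ _) ha)
      exact eventually_know_vote hE hs hp hq h hc
    choose! a ha using voted
    obtain ⟨b, hb⟩ := start p hp
    -- By the supremum of the times `a`, the votes of all correct processes are known to `p`; `Bᶜ`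
    -- is the set of voters.
    refine exists_rounds_of_certifies hE hp (i := max b (Bᶜ.sup a)) (v := v)
      (hb.trans (rounds_mono (le_max_left _ _))) ⟨Bᶜ, ?_, fun q hq => ?_⟩
    · rw [Finset.card_compl, Fintype.card_fin]
      omega
    · exact know_mono ((Finset.le_sup hq).trans (le_max_right _ _))
        (ha q (Finset.mem_compl.mp hq))

/-- Completing the group forces a delivery of some value with number `k`; integrity identifies that
value. -/
lemma voteProtocol_validity (hn : 2 * t + 1 ≤ n) (hB : B.card ≤ t)
    (hE : IsExecution (voteProtocol V t s) B s ev) (hs : s ∉ B) {k i : ℕ} {v : V}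
    (h : Broadcasts ev s k v i) {p : Fin n} (hp : p ∉ B) :
    ∃ j, (voteProtocol V t s).Delivers ev p k v j := by
  obtain ⟨j, hj⟩ := exists_rounds_of_broadcasts hn hB hE hs k h hp
  obtain ⟨a, -, w, hw⟩ := exists_delivers (h.2 ▸ Nat.le_add_left 1 _) hj
  obtain ⟨b, -, hb⟩ := voteProtocol_integrity hE hs hp hw
  obtain rfl := hb.inj h
  exact ⟨a, hw⟩

end Execution

lemma voteProtocol_solvesSRB (V : Type u) {t : ℕ} (hn : 2 * t + 1 ≤ n) (s : Fin n) :
    SolvesSRB (voteProtocol V t s) t s :=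
  ⟨voteProtocol_respectsSignatures V t s, fun _ hB _ hE =>
    { validity := fun hs _ _ _ h _ hp => voteProtocol_validity hn hB hE hs h hp
      agreement := fun _ _ _ _ hq h _ hp => voteProtocol_agreement hE hB hp hq h
      sequencing := fun _ _ _ _ _ h => voteProtocol_sequencing h
      integrity := fun hs _ _ _ _ hq h => voteProtocol_integrity hE hs hq h
      unique := fun _ _ _ _ _ _ _ h h' => voteProtocol_unique h h' }⟩

end SRB

theorem mainTheorem2 {V : Type u} (n t : ℕ) (hn : 2 * t + 1 ≤ n) (s : Fin n) :
    ∃ P : SRB.Protocol n V, SRB.SolvesSRB P t s :=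
  ⟨SRB.voteProtocol V t s, SRB.voteProtocol_solvesSRB V hn s⟩
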